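/- Let $K$ be a field of characteristic $0$. An initial Lie dialgebra over $K$ is a $K$-vector space with two bilinear products $\vdash,\dashv$ that satisfies, for all $a,b,c$, $$a\dashv(b\dashv c)=a\dashv(b\vdash c),\qquad (a\vdash b)\vdash c=(a\dashv b)\vdash c,\qquad a\dashv b=-\,b\vdash a,$$ $$(a\dashv b)\dashv c+(b\vdash c)\vdash a+(c\vdash a)\dashv b=0,\qquad (a\vdash b)\dashv c+(b\dashv c)\dashv a+(c\vdash a)\vdash b=0,$$ $$(a\vdash b)\vdash c+(b\vdash c)\dashv a+(c\dashv a)\dashv b=0$$ (that is, a Lie dialgebra; equivalently, a left Leibniz algebra with respect to $\vdash$), together with the additional identity $$(a\vdash b)\vdash c+(b\vdash c)\vdash a+(c\vdash a)\vdash b=0.$$ Put $[a,b]=a\vdash b-b\vdash a$ and $\{a,b\}=a\vdash b+b\vdash a$. Every initial Lie dialgebra is a Lie algebra with respect to $[\cdot,\cdot]$. Let $X$ be a linearly ordered set (we write $x_i\in X$, and order the indices as the elements of $X$), let $\mathrm{di}\text{-}\mathrm{Lie}^{\mathrm I}\langle X\rangle$ be the free initial Lie dialgebra on $X$, let $\mathrm{Lie}\langle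 X\rangle$ be the free Lie algebra on $X$ over $K$, and let $\varphi:\mathrm{Lie}\langle X\rangle\to \mathrm{di}\text{-}\mathrm{Lie}^{\mathrm I}\langle X\rangle$ be the homomorphism of Lie algebras (with respect to $[\cdot,\cdot]$ on the right) that is the identity on $X$. Let $\mathrm{Com}^S\langle X\rangle\subseteq \mathrm{di}\text{-}\mathrm{Lie}^{\mathrm I}\langle X\rangle$ be the linear span of the monomials $$\{\{\cdots\{\{x_{i_1},x_{i_2}\},x_{i_3}\},\cdots\},x_{i_n}\},\qquad n\ge 2,\quad i_1\le i_2,\quad i_3\le\cdots\le i_n. \tag{$*$}$$ **Theorem 4.1.** For every basis $\mathcal L$ of $\mathrm{Lie}\langle X\rangle$, the elements $\varphi(\ell)$, $\ell\in\mathcal L$, together with the monomials $(*)$ (for pairwise distinct index sequences $(i_1,\dots,i_n)$) are pairwise distinct and form a basis of $\mathrm{di}\text{-}\mathrm{Lie}^{\mathrm I}\langle X\rangle$. Moreover $\varphi$ is injective and, as a vector space, $$\mathrm{di}\text{-}\mathrm{Lie}^{\mathrm I}\langle X\rangle=\varphi(\mathrm{Lie}\langle X\rangle)\oplus \mathrm{Com}^S\langle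 X\rangle .$$ For every $n\ge 1$, the multilinear component $\mathrm{di}\text{-}\mathrm{Lie}^{\mathrm I}(n)$ of $\mathrm{di}\text{-}\mathrm{Lie}^{\mathrm I}\langle x_1,\dots,x_n\rangle$, spanned by the nonassociative monomials in $\vdash,\dashv$ in which each $x_i$ occurs exactly once, has dimension $$\dim \mathrm{di}\text{-}\mathrm{Lie}^{\mathrm I}(n)=(n-1)!+\frac{n(n-1)}{2}.$$ -/

import Mathlib

universe u v w

/-- A type with the two products `a ⊢ b` and `a ⊣ b` of a dialgebra. -/
class DiMul (A : Type u) where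
  /-- The product `a ⊢ b`. -/
  vdash : A → A → A
  /-- The product `a ⊣ b`. -/
  dashv : A → A → A

infixl:70 " ⊢ᵈ " => DiMul.vdash
infixl:70 " ⊣ᵈ " => DiMul.dashv

/-- The values in `A` of the defining identities of initial Lie dialgebras. The identities
`bar_right` and `bar_left` are the `0`-identities of all dialgebras. The identity `anticomm` is the
dialgebra form of `x y + y x = 0`. The identities `jacobi₁`, `jacobi₂`, `jacobi₃` are the three
dialgebra forms of `(x₁ x₂) x₃ + (x₂ x₃) x₁ + (x₃ x₁) x₂ = 0`: in the `i`-th one, all products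
point to the variable `xᵢ`. The identity `initial` is the additional identity that singles out the
initial ones among the Lie dialgebras. -/
inductive InitialLieRelator {A : Type u} [AddCommGroup A] [DiMul A] : A → Prop
  | bar_right (a b c : A) : InitialLieRelator (a ⊣ᵈ (b ⊣ᵈ c) - a ⊣ᵈ (b ⊢ᵈ c))
  | bar_left (a b c : A) : InitialLieRelator ((a ⊢ᵈ b) ⊢ᵈ c - (a ⊣ᵈ b) ⊢ᵈ c)
  | anticomm (a b : A) : InitialLieRelator (a ⊣ᵈ b + b ⊢ᵈ a)
  | jacobi₁ (a b c : A) :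
      InitialLieRelator ((a ⊣ᵈ b) ⊣ᵈ c + (b ⊢ᵈ c) ⊢ᵈ a + (c ⊢ᵈ a) ⊣ᵈ b)
  | jacobi₂ (a b c : A) :
      InitialLieRelator ((a ⊢ᵈ b) ⊣ᵈ c + (b ⊣ᵈ c) ⊣ᵈ a + (c ⊢ᵈ a) ⊢ᵈ b)
  | jacobi₃ (a b c : A) :
      InitialLieRelator ((a ⊢ᵈ b) ⊢ᵈ c + (b ⊢ᵈ c) ⊣ᵈ a + (c ⊣ᵈ a) ⊣ᵈ b)
  | initial (a b c : A) :
      InitialLieRelator ((a ⊢ᵈ b) ⊢ᵈ c + (b ⊢ᵈ c) ⊢ᵈ a + (c ⊢ᵈ a) ⊢ᵈ b)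

/-- An initial Lie dialgebra over `K`: a vector space with two bilinear products that satisfy the
identities above. -/
class InitialLieDialgebra (K : Type u) (A : Type v) [Field K] [AddCommGroup A] [Module K A]
    [DiMul A] : Prop where
  vdash_add : ∀ a b c : A, a ⊢ᵈ (b + c) = a ⊢ᵈ b + a ⊢ᵈ c
  add_vdash : ∀ a b c : A, (a + b) ⊢ᵈ c = a ⊢ᵈ c + b ⊢ᵈ c
  vdash_smul : ∀ (t : K) (a b : A), a ⊢ᵈ (t • b) = t • (a ⊢ᵈ b)
  smul_vdash : ∀ (t : K) (a b : A), (t • a) ⊢ᵈ b = t • (a ⊢ᵈ b)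
  dashv_add : ∀ a b c : A, a ⊣ᵈ (b + c) = a ⊣ᵈ b + a ⊣ᵈ c
  add_dashv : ∀ a b c : A, (a + b) ⊣ᵈ c = a ⊣ᵈ c + b ⊣ᵈ c
  dashv_smul : ∀ (t : K) (a b : A), a ⊣ᵈ (t • b) = t • (a ⊣ᵈ b)
  smul_dashv : ∀ (t : K) (a b : A), (t • a) ⊣ᵈ b = t • (a ⊣ᵈ b)
  relator_eq_zero : ∀ r : A, InitialLieRelator r → r = 0

/-- Nonassociative monomials in the variables `X` with respect to two products. -/
inductive DiMonomial (X : Type u) : Type u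
  | of : X → DiMonomial X
  | vdash : DiMonomial X → DiMonomial X → DiMonomial X
  | dashv : DiMonomial X → DiMonomial X → DiMonomial X

/-- The variables occurring in a monomial, with multiplicity. -/
def DiMonomial.vars {X : Type u} : DiMonomial X → Multiset X
  | .of x => {x}
  | .vdash m n => m.vars + n.vars
  | .dashv m n => m.vars + n.vars

/-- The free `K`-vector space with two bilinear products (and no identities) on the set `X`. -/
def FreeDiMulAlgebra (K : Type u) (X : Type v) [Field K] : Type (max u v) := DiMonomial X →₀ K

namespace FreeDiMulAlgebra

variable (K : Type u) (X : Type v) [Field K]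

noncomputable instance : AddCommGroup (FreeDiMulAlgebra K X) :=
  inferInstanceAs (AddCommGroup (DiMonomial X →₀ K))

noncomputable instance : Module K (FreeDiMulAlgebra K X) :=
  inferInstanceAs (Module K (DiMonomial X →₀ K))

variable {X} in
/-- A monomial as an element of the free algebra. -/
noncomputable def monomial (m : DiMonomial X) : FreeDiMulAlgebra K X := Finsupp.single m (1 : K)

/-- The bilinear extension of a product on monomials. -/
noncomputable def extend (p : DiMonomial X → DiMonomial X → DiMonomial X) :
    FreeDiMulAlgebra K X →ₗ[K] FreeDiMulAlgebra K X →ₗ[K] FreeDiMulAlgebra K X :=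
  Finsupp.linearCombination K fun m : DiMonomial X => Finsupp.lmapDomain K K (p m)

noncomputable instance : DiMul (FreeDiMulAlgebra K X) where
  vdash a b := extend K X DiMonomial.vdash a b
  dashv a b := extend K X DiMonomial.dashv a b

/-- Ideals with respect to both products. -/
structure IsIdeal (I : Submodule K (FreeDiMulAlgebra K X)) : Prop where
  vdash_mem_left : ∀ a b, a ∈ I → a ⊢ᵈ b ∈ I
  vdash_mem_right : ∀ a b, b ∈ I → a ⊢ᵈ b ∈ I
  dashv_mem_left : ∀ a b, a ∈ I → a ⊣ᵈ b ∈ I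
  dashv_mem_right : ∀ a b, b ∈ I → a ⊣ᵈ b ∈ I

/-- The smallest ideal that contains all values of the identities of initial Lie dialgebras. -/
noncomputable def initialLieIdeal : Submodule K (FreeDiMulAlgebra K X) :=
  sInf {I | IsIdeal K X I ∧ ∀ r, InitialLieRelator r → r ∈ I}

theorem isIdeal_initialLieIdeal : IsIdeal K X (initialLieIdeal K X) where
  vdash_mem_left a b h := by
    simp only [initialLieIdeal, Submodule.mem_sInf] at h ⊢
    exact fun I hI => hI.1.vdash_mem_left a b (h I hI)
  vdash_mem_right a b h := by
    simp only [initialLieIdeal, Submodule.mem_sInf] at h ⊢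
    exact fun I hI => hI.1.vdash_mem_right a b (h I hI)
  dashv_mem_left a b h := by
    simp only [initialLieIdeal, Submodule.mem_sInf] at h ⊢
    exact fun I hI => hI.1.dashv_mem_left a b (h I hI)
  dashv_mem_right a b h := by
    simp only [initialLieIdeal, Submodule.mem_sInf] at h ⊢
    exact fun I hI => hI.1.dashv_mem_right a b (h I hI)

theorem relator_mem_initialLieIdeal (r : FreeDiMulAlgebra K X) (h : InitialLieRelator r) :
    r ∈ initialLieIdeal K X := by
  simp only [initialLieIdeal, Submodule.mem_sInf]
  exact fun I hI => hI.2 r h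

end FreeDiMulAlgebra

/-- The free initial Lie dialgebra over `K` on the set `X`. -/
def FreeInitialLieDialgebra (K : Type u) (X : Type v) [Field K] : Type (max u v) :=
  FreeDiMulAlgebra K X ⧸ FreeDiMulAlgebra.initialLieIdeal K X

namespace FreeInitialLieDialgebra

variable (K : Type u) (X : Type v) [Field K]

noncomputable instance : AddCommGroup (FreeInitialLieDialgebra K X) :=
  inferInstanceAs (AddCommGroup (FreeDiMulAlgebra K X ⧸ FreeDiMulAlgebra.initialLieIdeal K X))

noncomputable instance : Module K (FreeInitialLieDialgebra K X) :=
  inferInstanceAs (Module K (FreeDiMulAlgebra K X ⧸ FreeDiMulAlgebra.initialLieIdeal K X))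

/-- The quotient map. -/
noncomputable def mk : FreeDiMulAlgebra K X →ₗ[K] FreeInitialLieDialgebra K X :=
  (FreeDiMulAlgebra.initialLieIdeal K X).mkQ

theorem mk_surjective : Function.Surjective (mk K X) :=
  Submodule.mkQ_surjective _

theorem mk_eq_zero (a : FreeDiMulAlgebra K X) :
    mk K X a = 0 ↔ a ∈ FreeDiMulAlgebra.initialLieIdeal K X :=
  Submodule.Quotient.mk_eq_zero _

/-- A bilinear product that preserves the ideal, on the quotient. -/
noncomputable def descend
    (f : FreeDiMulAlgebra K X →ₗ[K] FreeDiMulAlgebra K X →ₗ[K] FreeDiMulAlgebra K X)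
    (h₁ : ∀ a b, a ∈ FreeDiMulAlgebra.initialLieIdeal K X →
      f a b ∈ FreeDiMulAlgebra.initialLieIdeal K X)
    (h₂ : ∀ a b, b ∈ FreeDiMulAlgebra.initialLieIdeal K X →
      f a b ∈ FreeDiMulAlgebra.initialLieIdeal K X) :
    FreeInitialLieDialgebra K X →ₗ[K] FreeInitialLieDialgebra K X →ₗ[K]
      FreeInitialLieDialgebra K X :=
  Submodule.liftQ _
    (LinearMap.flip (Submodule.liftQ _ (LinearMap.flip (f.compr₂ (mk K X)))
      (fun b hb => by
        ext1 a
        exact (mk_eq_zero K X _).2 (h₂ a b hb))))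
    (fun a ha => by
      refine LinearMap.ext fun b => ?_
      obtain ⟨b, rfl⟩ := mk_surjective K X b
      exact (mk_eq_zero K X _).2 (h₁ a b ha))

noncomputable instance : DiMul (FreeInitialLieDialgebra K X) where
  vdash a b := descend K X (FreeDiMulAlgebra.extend K X DiMonomial.vdash)
    (FreeDiMulAlgebra.isIdeal_initialLieIdeal K X).vdash_mem_left
    (FreeDiMulAlgebra.isIdeal_initialLieIdeal K X).vdash_mem_right a b
  dashv a b := descend K X (FreeDiMulAlgebra.extend K X DiMonomial.dashv)
    (FreeDiMulAlgebra.isIdeal_initialLieIdeal K X).dashv_mem_left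
    (FreeDiMulAlgebra.isIdeal_initialLieIdeal K X).dashv_mem_right a b

theorem mk_vdash (a b : FreeDiMulAlgebra K X) : mk K X (a ⊢ᵈ b) = mk K X a ⊢ᵈ mk K X b := rfl

theorem mk_dashv (a b : FreeDiMulAlgebra K X) : mk K X (a ⊣ᵈ b) = mk K X a ⊣ᵈ mk K X b := rfl

instance : InitialLieDialgebra K (FreeInitialLieDialgebra K X) where
  vdash_add a b c := map_add _ b c
  add_vdash a b c := LinearMap.map_add₂ _ a b c
  vdash_smul t a b := map_smul _ t b
  smul_vdash t a b := LinearMap.map_smul₂ _ t a b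
  dashv_add a b c := map_add _ b c
  add_dashv a b c := LinearMap.map_add₂ _ a b c
  dashv_smul t a b := map_smul _ t b
  smul_dashv t a b := LinearMap.map_smul₂ _ t a b
  relator_eq_zero := by
    have key : ∀ r : FreeDiMulAlgebra K X, InitialLieRelator r → mk K X r = 0 := fun r hr =>
      (mk_eq_zero K X r).2 (FreeDiMulAlgebra.relator_mem_initialLieIdeal K X r hr)
    rintro r (⟨a, b, c⟩ | ⟨a, b, c⟩ | ⟨a, b⟩ | ⟨a, b, c⟩ | ⟨a, b, c⟩ | ⟨a, b, c⟩ | ⟨a, b, c⟩)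
    all_goals
      obtain ⟨a, rfl⟩ := mk_surjective K X a
      obtain ⟨b, rfl⟩ := mk_surjective K X b
    · obtain ⟨c, rfl⟩ := mk_surjective K X c
      exact key _ (.bar_right a b c)
    · obtain ⟨c, rfl⟩ := mk_surjective K X c
      exact key _ (.bar_left a b c)
    · exact key _ (.anticomm a b)
    · obtain ⟨c, rfl⟩ := mk_surjective K X c
      exact key _ (.jacobi₁ a b c)
    · obtain ⟨c, rfl⟩ := mk_surjective K X c
      exact key _ (.jacobi₂ a b c)
    · obtain ⟨c, rfl⟩ := mk_surjective K X c
      exact key _ (.jacobi₃ a b c)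
    · obtain ⟨c, rfl⟩ := mk_surjective K X c
      exact key _ (.initial a b c)

variable {X} in
/-- The free generators. -/
noncomputable def of (x : X) : FreeInitialLieDialgebra K X :=
  mk K X (FreeDiMulAlgebra.monomial K (.of x))

variable {K X}

theorem dashv_eq (a b : FreeInitialLieDialgebra K X) : a ⊣ᵈ b = -(b ⊢ᵈ a) :=
  eq_neg_of_add_eq_zero_left (InitialLieDialgebra.relator_eq_zero (K := K) _ (.anticomm a b))

theorem vdash_add (a b c : FreeInitialLieDialgebra K X) : a ⊢ᵈ (b + c) = a ⊢ᵈ b + a ⊢ᵈ c :=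
  InitialLieDialgebra.vdash_add K a b c

theorem add_vdash (a b c : FreeInitialLieDialgebra K X) : (a + b) ⊢ᵈ c = a ⊢ᵈ c + b ⊢ᵈ c :=
  InitialLieDialgebra.add_vdash K a b c

theorem vdash_neg (a b : FreeInitialLieDialgebra K X) : a ⊢ᵈ (-b) = -(a ⊢ᵈ b) := by
  rw [← neg_one_smul K b, InitialLieDialgebra.vdash_smul, neg_one_smul]

theorem neg_vdash (a b : FreeInitialLieDialgebra K X) : (-a) ⊢ᵈ b = -(a ⊢ᵈ b) := by
  rw [← neg_one_smul K a, InitialLieDialgebra.smul_vdash, neg_one_smul]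

theorem vdash_sub (a b c : FreeInitialLieDialgebra K X) : a ⊢ᵈ (b - c) = a ⊢ᵈ b - a ⊢ᵈ c := by
  rw [sub_eq_add_neg, vdash_add, vdash_neg, ← sub_eq_add_neg]

theorem sub_vdash (a b c : FreeInitialLieDialgebra K X) : (a - b) ⊢ᵈ c = a ⊢ᵈ c - b ⊢ᵈ c := by
  rw [sub_eq_add_neg, add_vdash, neg_vdash, ← sub_eq_add_neg]

theorem leibniz (a b c : FreeInitialLieDialgebra K X) :
    (a ⊢ᵈ b) ⊢ᵈ c = a ⊢ᵈ (b ⊢ᵈ c) - b ⊢ᵈ (a ⊢ᵈ c) := by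
  have h := InitialLieDialgebra.relator_eq_zero (K := K) _ (.jacobi₃ a b c)
  simp only [dashv_eq, vdash_neg, neg_neg] at h
  rw [← sub_eq_zero, ← h]
  abel

theorem initial_identity (a b c : FreeInitialLieDialgebra K X) :
    (a ⊢ᵈ b) ⊢ᵈ c + (b ⊢ᵈ c) ⊢ᵈ a + (c ⊢ᵈ a) ⊢ᵈ b = 0 :=
  InitialLieDialgebra.relator_eq_zero (K := K) _ (.initial a b c)

/-- The commutator `[a, b] = a ⊢ b - b ⊢ a = a ⊢ b + a ⊣ b` makes the free initial Lie dialgebra a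
Lie algebra. -/
noncomputable instance : LieRing (FreeInitialLieDialgebra K X) where
  bracket a b := a ⊢ᵈ b - b ⊢ᵈ a
  add_lie a b c := by
    change (a + b) ⊢ᵈ c - c ⊢ᵈ (a + b) = a ⊢ᵈ c - c ⊢ᵈ a + (b ⊢ᵈ c - c ⊢ᵈ b)
    rw [add_vdash, vdash_add]
    abel
  lie_add a b c := by
    change a ⊢ᵈ (b + c) - (b + c) ⊢ᵈ a = a ⊢ᵈ b - b ⊢ᵈ a + (a ⊢ᵈ c - c ⊢ᵈ a)
    rw [add_vdash, vdash_add]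
    abel
  lie_self a := sub_self _
  leibniz_lie a b c := by
    change a ⊢ᵈ (b ⊢ᵈ c - c ⊢ᵈ b) - (b ⊢ᵈ c - c ⊢ᵈ b) ⊢ᵈ a =
      (a ⊢ᵈ b - b ⊢ᵈ a) ⊢ᵈ c - c ⊢ᵈ (a ⊢ᵈ b - b ⊢ᵈ a) +
        (b ⊢ᵈ (a ⊢ᵈ c - c ⊢ᵈ a) - (a ⊢ᵈ c - c ⊢ᵈ a) ⊢ᵈ b)
    have h := initial_identity a b c
    simp only [leibniz] at h
    simp only [vdash_sub, sub_vdash, leibniz]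
    rw [← sub_eq_zero, ← neg_eq_zero, ← h]
    abel

theorem lie_def (a b : FreeInitialLieDialgebra K X) : ⁅a, b⁆ = a ⊢ᵈ b - b ⊢ᵈ a := rfl

noncomputable instance : LieAlgebra K (FreeInitialLieDialgebra K X) where
  lie_smul t a b := by
    rw [lie_def, lie_def, InitialLieDialgebra.vdash_smul, InitialLieDialgebra.smul_vdash, smul_sub]

/-- The anticommutator `{a, b} = a ⊢ b + b ⊢ a`. -/
noncomputable def anticomm (a b : FreeInitialLieDialgebra K X) : FreeInitialLieDialgebra K X :=
  a ⊢ᵈ b + b ⊢ᵈ a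

variable (K X)

/-- The map from the free Lie algebra to the free initial Lie dialgebra with its commutator that is
the identity on the generators: it evaluates a Lie polynomial by means of commutators. -/
noncomputable def ofLie : FreeLieAlgebra K X →ₗ⁅K⁆ FreeInitialLieDialgebra K X :=
  FreeLieAlgebra.lift K (of K)

end FreeInitialLieDialgebra

/-- The indices `(i₁, i₂, i₃, …, iₙ)`, `n ≥ 2`, with `i₁ ≤ i₂` and `i₃ ≤ … ≤ iₙ`. -/
structure ComSIndex (X : Type u) [LinearOrder X] : Type u where
  /-- The index `i₁`. -/
  fst : X
  /-- The index `i₂`. -/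
  snd : X
  /-- The indices `i₃, …, iₙ`; the list is empty for `n = 2`. -/
  tail : List X
  fst_le_snd : fst ≤ snd
  tail_sorted : tail.Pairwise (· ≤ ·)

namespace FreeInitialLieDialgebra

variable (K : Type u) {X : Type v} [Field K] [LinearOrder X]

/-- The left-normed monomial `{{⋯{{x_{i₁}, x_{i₂}}, x_{i₃}}, ⋯}, x_{iₙ}}`. -/
noncomputable def comSMonomial (j : ComSIndex X) : FreeInitialLieDialgebra K X :=
  j.tail.foldl (fun a x => anticomm a (of K x)) (anticomm (of K j.fst) (of K j.snd))

variable (X) in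
/-- The space `Com^S⟨X⟩` spanned by the monomials `{{⋯{{x_{i₁}, x_{i₂}}, x_{i₃}}, ⋯}, x_{iₙ}}` with
`n ≥ 2`, `i₁ ≤ i₂` and `i₃ ≤ … ≤ iₙ`. -/
noncomputable def comS : Submodule K (FreeInitialLieDialgebra K X) :=
  Submodule.span K (Set.range (comSMonomial K))

/-- The multilinear component of degree `n`: the span of the (nonassociative) monomials in
`x₁, …, xₙ` in which each of these variables occurs exactly once. -/
noncomputable def multilinear (n : ℕ) : Submodule K (FreeInitialLieDialgebra K (Fin n)) :=
  Submodule.span K ((fun m => mk K (Fin n) (FreeDiMulAlgebra.monomial K m)) ''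
    {m : DiMonomial (Fin n) | m.vars = Finset.univ.val})

end FreeInitialLieDialgebra

/-! Every product splits as a ⊢ b = ½[a,b] + ½{a,b}. By the Leibniz identity an anticommutator
annihilates everything when it stands on the left. The left annihilator is stable under left
multiplications, and by the initial identity every product a ⊢ b acts on it by zero
(`vdash_vdash_eq_zero`). So the generators act on it by commuting operators {m,x} = x ⊢ m, which is
why the letters from the third on can be sorted. The identity {[a,b],c} = a ⊢ {b,c} - b ⊢ {a,c}
(`anticomm_lie`) reduces anticommutators of Lie words to those of generators. Hence φ(Lie⟨X⟩) +
Com^S⟨X⟩ is closed under ⊢ (`vdash_mem_sup`) and is the whole algebra.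

Two models show that there are no further relations. A Lie algebra with the product ½[a,b] is an
initial Lie dialgebra with zero anticommutators; this yields a retraction onto Lie⟨X⟩ that kills
Com^S⟨X⟩ (`exists_retraction`). The model on triples of polynomials sends the monomials (*) to
distinct commutative monomials y_{i₁} y_{i₂} x_{i₃} ⋯ x_{iₙ}.

For the dimension, the spanning argument keeps track of the multiset of letters. In the multilinear
case the Lie part is spanned by the (n-1)! right-normed commutators with a fixed last letter,
independent by a matrix representation, and the other part is indexed by the pairs i₁ < i₂. -/

namespace FreeInitialLieDialgebra

/-! ### Universal property -/

section Lift

variable {K : Type u} [Field K] {X : Type v}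

theorem of_induction {P : FreeInitialLieDialgebra K X → Prop}
    (h : ∀ m, P (mk K X (FreeDiMulAlgebra.monomial K m)))
    (h0 : P 0) (hadd : ∀ a b, P a → P b → P (a + b)) (hsmul : ∀ (t : K) a, P a → P (t • a))
    (a : FreeInitialLieDialgebra K X) : P a := by
  obtain ⟨a, rfl⟩ := mk_surjective K X a
  induction a using Finsupp.induction_linear with
  | zero => exact (map_zero (mk K X)).symm ▸ h0
  | add f g hf hg => exact (map_add (mk K X) f g).symm ▸ hadd _ _ hf hg
  | single m t =>
    have : (Finsupp.single m t : FreeDiMulAlgebra K X) = t • FreeDiMulAlgebra.monomial K m := by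
      exact (Finsupp.smul_single_one m t).symm
    rw [this, map_smul]
    exact hsmul _ _ (h m)

variable {B : Type w} [AddCommGroup B] [Module K B]

/-- The value of a nonassociative monomial for a product `p` on `B`, where `a ⊣ b = -p b a`. -/
def evalMonomial (p : B →ₗ[K] B →ₗ[K] B) (f : X → B) : DiMonomial X → B
  | .of x => f x
  | .vdash m n => p (evalMonomial p f m) (evalMonomial p f n)
  | .dashv m n => -p (evalMonomial p f n) (evalMonomial p f m)

/-- The linear extension of `evalMonomial`. -/
noncomputable def evalLinear (p : B →ₗ[K] B →ₗ[K] B) (f : X → B) :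
    FreeDiMulAlgebra K X →ₗ[K] B :=
  Finsupp.linearCombination K (evalMonomial p f)

theorem evalLinear_monomial (p : B →ₗ[K] B →ₗ[K] B) (f : X → B) (m : DiMonomial X) :
    evalLinear p f (FreeDiMulAlgebra.monomial K m) = evalMonomial p f m := by
  exact (Finsupp.linearCombination_single K (1 : K) m).trans (one_smul K _)

theorem extend_monomial (q : DiMonomial X → DiMonomial X → DiMonomial X) (m n : DiMonomial X) :
    FreeDiMulAlgebra.extend K X q (FreeDiMulAlgebra.monomial K m)
      (FreeDiMulAlgebra.monomial K n) = FreeDiMulAlgebra.monomial K (q m n) := by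
  have h : FreeDiMulAlgebra.extend K X q (FreeDiMulAlgebra.monomial K m) =
      Finsupp.lmapDomain K K (q m) :=
    (Finsupp.linearCombination_single K (1 : K) m).trans (one_smul K _)
  rw [h]
  exact Finsupp.mapDomain_single

theorem mk_monomial_vdash (m n : DiMonomial X) :
    mk K X (FreeDiMulAlgebra.monomial K (.vdash m n)) =
      mk K X (FreeDiMulAlgebra.monomial K m) ⊢ᵈ mk K X (FreeDiMulAlgebra.monomial K n) := by
  rw [← mk_vdash, ← extend_monomial]; rfl

theorem mk_monomial_dashv (m n : DiMonomial X) :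
    mk K X (FreeDiMulAlgebra.monomial K (.dashv m n)) =
      mk K X (FreeDiMulAlgebra.monomial K m) ⊣ᵈ mk K X (FreeDiMulAlgebra.monomial K n) := by
  rw [← mk_dashv, ← extend_monomial]; rfl

theorem linearMap_ext₂ {f g : FreeDiMulAlgebra K X →ₗ[K] FreeDiMulAlgebra K X →ₗ[K] B}
    (h : ∀ m n, f (FreeDiMulAlgebra.monomial K m) (FreeDiMulAlgebra.monomial K n) =
      g (FreeDiMulAlgebra.monomial K m) (FreeDiMulAlgebra.monomial K n)) : f = g := by
  refine Finsupp.lhom_ext' fun m => LinearMap.ext_ring ?_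
  refine Finsupp.lhom_ext' fun n => LinearMap.ext_ring ?_
  exact h m n

theorem evalLinear_vdash (p : B →ₗ[K] B →ₗ[K] B) (f : X → B) (a b : FreeDiMulAlgebra K X) :
    evalLinear p f (a ⊢ᵈ b) = p (evalLinear p f a) (evalLinear p f b) := by
  have : (FreeDiMulAlgebra.extend K X DiMonomial.vdash).compr₂ (evalLinear p f) =
      p.compl₁₂ (evalLinear p f) (evalLinear p f) := by
    refine linearMap_ext₂ fun m n => ?_
    simp only [LinearMap.compr₂_apply, LinearMap.compl₁₂_apply, extend_monomial,
      evalLinear_monomial, evalMonomial]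
  exact LinearMap.congr_fun₂ this a b

theorem evalLinear_dashv (p : B →ₗ[K] B →ₗ[K] B) (f : X → B) (a b : FreeDiMulAlgebra K X) :
    evalLinear p f (a ⊣ᵈ b) = -p (evalLinear p f b) (evalLinear p f a) := by
  have : (FreeDiMulAlgebra.extend K X DiMonomial.dashv).compr₂ (evalLinear p f) =
      -(p.flip.compl₁₂ (evalLinear p f) (evalLinear p f)) := by
    refine linearMap_ext₂ fun m n => ?_
    simp only [LinearMap.compr₂_apply, LinearMap.neg_apply, LinearMap.compl₁₂_apply,
      LinearMap.flip_apply, extend_monomial, evalLinear_monomial, evalMonomial]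
  exact LinearMap.congr_fun₂ this a b

/-- The universal property of the free initial Lie dialgebra, for a left Leibniz product `p` that
satisfies the initial identity. -/
theorem exists_lift (p : B →ₗ[K] B →ₗ[K] B)
    (leib : ∀ a b c, p (p a b) c = p a (p b c) - p b (p a c))
    (init : ∀ a b c, p (p a b) c + p (p b c) a + p (p c a) b = 0) (f : X → B) :
    ∃ F : FreeInitialLieDialgebra K X →ₗ[K] B,
      (∀ x, F (of K x) = f x) ∧ ∀ a b, F (a ⊢ᵈ b) = p (F a) (F b) := by
  -- The right side of the Leibniz identity is antisymmetric in `a`, `b`; this yields both bar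
  -- identities.
  have skew : ∀ a b c, p (p a b) c = -p (p b a) c := fun a b c => by
    rw [leib, leib b a]; abel
  have hle : FreeDiMulAlgebra.initialLieIdeal K X ≤ LinearMap.ker (evalLinear p f) := by
    refine sInf_le ⟨⟨?_, ?_, ?_, ?_⟩, ?_⟩
    · intro a b h
      rw [LinearMap.mem_ker] at h ⊢
      rw [evalLinear_vdash, h]; simp
    · intro a b h
      rw [LinearMap.mem_ker] at h ⊢
      rw [evalLinear_vdash, h]; simp
    · intro a b h
      rw [LinearMap.mem_ker] at h ⊢
      rw [evalLinear_dashv, h]; simp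
    · intro a b h
      rw [LinearMap.mem_ker] at h ⊢
      rw [evalLinear_dashv, h]; simp
    · rintro r (⟨a, b, c⟩ | ⟨a, b, c⟩ | ⟨a, b⟩ | ⟨a, b, c⟩ | ⟨a, b, c⟩ | ⟨a, b, c⟩ | ⟨a, b, c⟩)
      all_goals
        rw [LinearMap.mem_ker]
        simp only [map_add, map_sub, evalLinear_vdash, evalLinear_dashv, map_neg,
          LinearMap.neg_apply, neg_neg]
        generalize evalLinear p f a = a
        generalize evalLinear p f b = b
      -- Anticommutativity is the only relator without `c`; it vanishes by the choice of ⊣.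
      on_goal 3 => abel
      all_goals generalize evalLinear p f c = c
      · rw [skew b c]; abel
      · rw [skew a b]; abel
      -- Each form of the Jacobi identity is the Leibniz identity for a cyclic shift of `a`, `b`,
      -- `c`.
      · rw [leib b c a]; abel
      · rw [leib c a b]; abel
      · rw [leib a b c]; abel
      · exact init a b c
  refine ⟨Submodule.liftQ _ (evalLinear p f) hle, fun x => ?_, fun a b => ?_⟩
  · exact evalLinear_monomial p f (.of x)
  · obtain ⟨a, rfl⟩ := mk_surjective K X a
    obtain ⟨b, rfl⟩ := mk_surjective K X b
    exact evalLinear_vdash p f a b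

/-- A map to a Lie algebra extends to a homomorphism of Lie algebras that vanishes on
anticommutators. -/
theorem exists_lieLift [NeZero (2 : K)] {L : Type w} [LieRing L] [LieAlgebra K L] (f : X → L) :
    ∃ F : FreeInitialLieDialgebra K X →ₗ⁅K⁆ L,
      (∀ x, F (of K x) = f x) ∧ ∀ a b, F (anticomm a b) = 0 := by
  have two : (2 : K) ≠ 0 := NeZero.ne _
  -- The factor ½ makes the commutator of the new product equal to the original bracket; the Leibniz
  -- and initial identities are both the Jacobi identity.
  obtain ⟨F, hof, hF⟩ := exists_lift (K := K) ((2 : K)⁻¹ • (LieModule.toEnd K L L : L →ₗ[K] _))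
    (fun a b c => by
      simp only [LinearMap.smul_apply, map_smul, LieHom.coe_toLinearMap,
        LieModule.toEnd_apply_apply, lie_lie, smul_sub])
    (fun a b c => by
      have := lie_jacobi a b c
      simp only [LinearMap.smul_apply, map_smul, LieHom.coe_toLinearMap,
        LieModule.toEnd_apply_apply, ← smul_add]
      rw [← lie_skew ⁅a, b⁆ c, ← lie_skew ⁅b, c⁆ a, ← lie_skew ⁅c, a⁆ b, ← neg_add, ← neg_add,
        show ⁅c, ⁅a, b⁆⁆ + ⁅a, ⁅b, c⁆⁆ + ⁅b, ⁅c, a⁆⁆ = 0 by rw [← this]; abel]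
      simp) f
  simp only [LinearMap.smul_apply, LieHom.coe_toLinearMap, LieModule.toEnd_apply_apply] at hF
  refine ⟨{ F with map_lie' := fun {a b} => ?_ }, hof, fun a b => ?_⟩
  · change F (a ⊢ᵈ b - b ⊢ᵈ a) = ⁅F a, F b⁆
    rw [map_sub, hF, hF, ← lie_skew (F a) (F b), ← smul_sub, sub_eq_add_neg, ← neg_add, ← two_smul K,
      ← smul_neg, smul_smul, inv_mul_cancel₀ two, one_smul]
  · change F (a ⊢ᵈ b + b ⊢ᵈ a) = 0
    rw [map_add, hF, hF, ← lie_skew (F a) (F b), smul_neg, neg_add_cancel]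

end Lift

/-! ### Anticommutators and the left annihilator -/

section Words

variable {K : Type u} [Field K] {X : Type v}

local notation "A" => FreeInitialLieDialgebra K X

theorem smul_vdash (t : K) (a b : A) : (t • a) ⊢ᵈ b = t • (a ⊢ᵈ b) :=
  InitialLieDialgebra.smul_vdash t a b

theorem vdash_smul (t : K) (a b : A) : a ⊢ᵈ (t • b) = t • (a ⊢ᵈ b) :=
  InitialLieDialgebra.vdash_smul t a b

theorem zero_vdash (a : A) : (0 : A) ⊢ᵈ a = 0 := by
  simpa using smul_vdash (0 : K) (0 : A) a

theorem vdash_zero (a : A) : a ⊢ᵈ (0 : A) = 0 := by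
  simpa using vdash_smul (0 : K) a (0 : A)

theorem anticomm_comm (a b : A) : anticomm a b = anticomm b a := add_comm _ _

theorem anticomm_vdash (a b c : A) : anticomm a b ⊢ᵈ c = 0 := by
  rw [anticomm, add_vdash, leibniz, leibniz b a]; abel

variable (K X) in
/-- The left annihilator. -/
def leftAnnihilator : Submodule K A where
  carrier := {m | ∀ c : A, m ⊢ᵈ c = 0}
  add_mem' ha hb c := by rw [add_vdash, ha, hb, add_zero]
  zero_mem' := zero_vdash
  smul_mem' t a ha c := by rw [smul_vdash, ha, smul_zero]

theorem anticomm_mem_leftAnnihilator (a b : A) : anticomm a b ∈ leftAnnihilator K X :=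
  anticomm_vdash a b

theorem vdash_mem_leftAnnihilator (a : A) {m : A} (hm : m ∈ leftAnnihilator K X) :
    a ⊢ᵈ m ∈ leftAnnihilator K X := fun c => by
  rw [leibniz, hm, hm, vdash_zero, sub_zero]

theorem anticomm_eq_vdash (a : A) {m : A} (hm : m ∈ leftAnnihilator K X) :
    anticomm m a = a ⊢ᵈ m := by
  rw [anticomm, hm, zero_add]

/-- The other two terms of the initial identity for `a`, `b`, `m` have `b ⊢ᵈ m` or `m` as a left
factor. -/
theorem vdash_vdash_eq_zero (a b : A) {m : A} (hm : m ∈ leftAnnihilator K X) :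
    (a ⊢ᵈ b) ⊢ᵈ m = 0 := by
  have h := initial_identity a b m
  rwa [vdash_mem_leftAnnihilator b hm, hm, zero_vdash, add_zero, add_zero] at h

theorem lie_vdash_eq_zero (a b : A) {m : A} (hm : m ∈ leftAnnihilator K X) :
    ⁅a, b⁆ ⊢ᵈ m = 0 := by
  rw [lie_def, sub_vdash, vdash_vdash_eq_zero a b hm, vdash_vdash_eq_zero b a hm, sub_zero]

theorem vdash_left_comm (a b : A) {m : A} (hm : m ∈ leftAnnihilator K X) :
    a ⊢ᵈ (b ⊢ᵈ m) = b ⊢ᵈ (a ⊢ᵈ m) := by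
  rw [← sub_eq_zero, ← leibniz, vdash_vdash_eq_zero a b hm]

/-- Once everything is right-normed by `leibniz`, the difference of the two sides is the left side
of the initial identity. This is the recursion for anticommutators of Lie words. -/
theorem anticomm_lie (a b c : A) :
    anticomm ⁅a, b⁆ c = a ⊢ᵈ anticomm b c - b ⊢ᵈ anticomm a c := by
  rw [← sub_eq_zero]
  have h := initial_identity a b c
  simp only [anticomm, lie_def, vdash_sub, sub_vdash, vdash_add, leibniz] at h ⊢
  rw [← h]
  abel

end Words

end FreeInitialLieDialgebra

/-- The multiset of all indices `i₁, …, iₙ`. -/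
def ComSIndex.vars {X : Type u} [LinearOrder X] (j : ComSIndex X) : Multiset X :=
  j.fst ::ₘ j.snd ::ₘ ↑j.tail

namespace FreeInitialLieDialgebra

/-! ### Spanning, with the multiset of letters recorded -/

section Spanning

variable (K : Type u) [Field K] {X : Type v}

local notation "A" => FreeInitialLieDialgebra K X

/-- The right-normed commutator `[x₁, [x₂, ⋯, [xₖ, z]]]`. -/
noncomputable def lieWord (l : List X) (z : X) : A :=
  l.foldr (fun y a => ⁅of K y, a⁆) (of K z)

theorem lieWord_cons (x : X) (l : List X) (z : X) :
    lieWord K (x :: l) z = ⁅of K x, lieWord K l z⁆ := rfl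

theorem lieWord_mem_range (l : List X) (z : X) :
    lieWord K l z ∈ LinearMap.range (ofLie K X).toLinearMap := by
  induction l with
  | nil => exact ⟨FreeLieAlgebra.of K z, FreeLieAlgebra.lift_of_apply (of K) z⟩
  | cons y l ih =>
    obtain ⟨u, hu⟩ := ih
    refine ⟨⁅FreeLieAlgebra.of K y, u⁆, ?_⟩
    rw [lieWord_cons, ← hu]
    exact ((ofLie K X).map_lie _ _).trans
      (congrArg (⁅·, _⁆) (FreeLieAlgebra.lift_of_apply (of K) y))

/-- The span of the right-normed commutators of content `s`. -/
noncomputable def lieWordSpan (s : Multiset X) : Submodule K A :=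
  Submodule.span K {a | ∃ (l : List X) (z : X), z ::ₘ ↑l = s ∧ lieWord K l z = a}

/-- The span of the right-normed commutators of content `s` with last letter `z`. -/
noncomputable def lieWordSpanOf (z : X) (s : Multiset X) : Submodule K A :=
  Submodule.span K {a | ∃ l : List X, z ::ₘ ↑l = s ∧ lieWord K l z = a}

variable {K}

theorem of_lie_mem_lieWordSpanOf {z : X} {s : Multiset X} (x : X) {a : A}
    (ha : a ∈ lieWordSpanOf K z s) : ⁅of K x, a⁆ ∈ lieWordSpanOf K z (x ::ₘ s) := by
  induction ha using Submodule.span_induction with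
  | mem a h =>
    obtain ⟨l, rfl, rfl⟩ := h
    exact Submodule.subset_span ⟨x :: l, by rw [← Multiset.cons_coe, Multiset.cons_swap], rfl⟩
  | zero => rw [lie_zero]; exact zero_mem _
  | add a b _ _ ha hb => rw [lie_add]; exact add_mem ha hb
  | smul t a _ ha => rw [lie_smul]; exact Submodule.smul_mem _ _ ha

/-- By the Jacobi identity, bracketing with a right-normed word is an iterated commutator of
brackets with letters, and these keep the last letter `z`. -/
theorem lieWord_lie_mem_lieWordSpanOf {z : X} (l : List X) (x : X) :
    ∀ {s : Multiset X} {a : A}, a ∈ lieWordSpanOf K z s →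
      ⁅lieWord K l x, a⁆ ∈ lieWordSpanOf K z (x ::ₘ ↑l + s) := by
  induction l with
  | nil =>
    intro s a ha
    simpa [lieWord] using of_lie_mem_lieWordSpanOf x ha
  | cons y l ih =>
    intro s a ha
    rw [lieWord_cons, lie_lie]
    refine sub_mem ?_ ?_
    · convert of_lie_mem_lieWordSpanOf y (ih ha) using 2
      simp only [← Multiset.cons_coe, ← Multiset.singleton_add]
      abel
    · convert ih (of_lie_mem_lieWordSpanOf y ha) using 2
      simp only [← Multiset.cons_coe, ← Multiset.singleton_add]
      abel

theorem lieWord_mem_lieWordSpanOf {z : X} (l : List X) (x : X) (hz : z ∈ x ::ₘ (l : Multiset X)) :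
    lieWord K l x ∈ lieWordSpanOf K z (x ::ₘ ↑l) := by
  induction l with
  | nil =>
    obtain rfl : z = x := by simpa using hz
    exact Submodule.subset_span ⟨[], rfl, rfl⟩
  | cons y l ih =>
    rw [← Multiset.cons_coe, Multiset.cons_swap]
    by_cases h : z ∈ x ::ₘ (l : Multiset X)
    · exact of_lie_mem_lieWordSpanOf y (ih h)
    -- Here `z` occurs only as the first letter; skew symmetry puts it at the end.
    · obtain rfl : z = y := by
        simp only [Multiset.mem_cons, ← Multiset.cons_coe] at hz h
        tauto
      rw [lieWord_cons, ← lie_skew, neg_mem_iff]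
      have hof : of K z ∈ lieWordSpanOf K z {z} := Submodule.subset_span ⟨[], rfl, rfl⟩
      convert lieWord_lie_mem_lieWordSpanOf l x hof using 1
      rw [add_comm, Multiset.singleton_add]

theorem lieWordSpan_le {z : X} {s : Multiset X} (hz : z ∈ s) :
    lieWordSpan K s ≤ lieWordSpanOf K z s := by
  refine Submodule.span_le.2 ?_
  rintro _ ⟨l, x, rfl, rfl⟩
  exact lieWord_mem_lieWordSpanOf l x hz

theorem lieWordSpanOf_le (z : X) (s : Multiset X) :
    lieWordSpanOf K z s ≤ lieWordSpan K s := by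
  refine Submodule.span_le.2 ?_
  rintro _ ⟨l, h, rfl⟩
  exact Submodule.subset_span ⟨l, z, h, rfl⟩

theorem lie_mem_lieWordSpan {s t : Multiset X} {a b : A} (ha : a ∈ lieWordSpan K s)
    (hb : b ∈ lieWordSpan K t) : ⁅a, b⁆ ∈ lieWordSpan K (s + t) := by
  induction ha using Submodule.span_induction with
  | mem a h =>
    obtain ⟨l, x, rfl, rfl⟩ := h
    induction hb using Submodule.span_induction with
    | mem b h =>
      obtain ⟨l', z, rfl, rfl⟩ := h
      exact lieWordSpanOf_le z _ (lieWord_lie_mem_lieWordSpanOf l x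
        (Submodule.subset_span ⟨l', rfl, rfl⟩))
    | zero => rw [lie_zero]; exact zero_mem _
    | add a b _ _ ha hb => rw [lie_add]; exact add_mem ha hb
    | smul t a _ ha => rw [lie_smul]; exact Submodule.smul_mem _ _ ha
  | zero => rw [zero_lie]; exact zero_mem _
  | add a b _ _ ha hb => rw [add_lie]; exact add_mem ha hb
  | smul t a _ ha => rw [smul_lie]; exact Submodule.smul_mem _ _ ha

theorem foldl_anticomm_mem (l : List X) {m : A} (hm : m ∈ leftAnnihilator K X) :
    l.foldl (fun a x => anticomm a (of K x)) m ∈ leftAnnihilator K X := by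
  induction l generalizing m with
  | nil => exact hm
  | cons x l ih => exact ih (anticomm_mem_leftAnnihilator _ _)

/-- On the left annihilator, {m,x} = x ⊢ m, and these operators commute. -/
theorem foldl_anticomm_perm {l l' : List X} (h : l.Perm l') {m : A}
    (hm : m ∈ leftAnnihilator K X) :
    l.foldl (fun a x => anticomm a (of K x)) m = l'.foldl (fun a x => anticomm a (of K x)) m := by
  induction h generalizing m with
  | nil => rfl
  | cons x _ ih => exact ih (anticomm_mem_leftAnnihilator _ _)
  | swap x y l =>
    simp only [List.foldl_cons]
    congr 1
    rw [anticomm_eq_vdash _ (anticomm_mem_leftAnnihilator _ _),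
      anticomm_eq_vdash _ (anticomm_mem_leftAnnihilator _ _), anticomm_eq_vdash _ hm,
      anticomm_eq_vdash _ hm, vdash_left_comm _ _ hm]
  | trans _ _ ih₁ ih₂ => exact (ih₁ hm).trans (ih₂ hm)

variable [LinearOrder X]

variable (K) in
/-- The span of the monomials `comSMonomial` of content `s`. -/
noncomputable def comSSpan (s : Multiset X) : Submodule K A :=
  Submodule.span K {a | ∃ j : ComSIndex X, j.vars = s ∧ comSMonomial K j = a}

theorem comSSpan_le_leftAnnihilator (s : Multiset X) :
    comSSpan K s ≤ leftAnnihilator K X := by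
  refine Submodule.span_le.2 ?_
  rintro _ ⟨j, -, rfl⟩
  exact foldl_anticomm_mem _ (anticomm_mem_leftAnnihilator _ _)

theorem foldl_anticomm_mem_comSSpan (l : List X) (x y : X) :
    l.foldl (fun a x => anticomm a (of K x)) (anticomm (of K x) (of K y)) ∈
      comSSpan K (x ::ₘ y ::ₘ ↑l) := by
  wlog h : x ≤ y generalizing x y
  · rw [anticomm_comm, Multiset.cons_swap]
    exact this y x (le_of_not_ge h)
  have hl := List.perm_insertionSort (· ≤ ·) l
  rw [foldl_anticomm_perm hl.symm (anticomm_mem_leftAnnihilator _ _), ← Multiset.coe_eq_coe.2 hl]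
  exact Submodule.subset_span
    ⟨⟨x, y, l.insertionSort (· ≤ ·), h, List.pairwise_insertionSort _ _⟩, rfl, rfl⟩

theorem of_vdash_mem_comSSpan (x : X) {s : Multiset X} {a : A} (ha : a ∈ comSSpan K s) :
    of K x ⊢ᵈ a ∈ comSSpan K (x ::ₘ s) := by
  induction ha using Submodule.span_induction with
  | mem a h =>
    obtain ⟨j, rfl, rfl⟩ := h
    convert foldl_anticomm_mem_comSSpan (K := K) (j.tail ++ [x]) j.fst j.snd using 1
    rotate_left
    · rw [List.foldl_append, List.foldl_cons, List.foldl_nil, anticomm_eq_vdash]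
      · rfl
      · exact foldl_anticomm_mem _ (anticomm_mem_leftAnnihilator _ _)
    · simp only [ComSIndex.vars, ← Multiset.coe_add, Multiset.coe_singleton,
        ← Multiset.singleton_add]
      congr 1
      abel
  | zero => rw [vdash_zero]; exact zero_mem _
  | add a b _ _ ha hb => rw [vdash_add]; exact add_mem ha hb
  | smul t a _ ha => rw [vdash_smul]; exact Submodule.smul_mem _ _ ha

/-- A single letter is appended to the tail; a longer word is a commutator and acts on the left
annihilator by zero. -/
theorem lieWord_vdash_mem_comSSpan (l : List X) (x : X) {s : Multiset X} {a : A}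
    (ha : a ∈ comSSpan K s) : lieWord K l x ⊢ᵈ a ∈ comSSpan K (x ::ₘ ↑l + s) := by
  cases l with
  | nil => simpa [lieWord] using of_vdash_mem_comSSpan x ha
  | cons y l =>
    rw [lieWord_cons, lie_vdash_eq_zero _ _ (comSSpan_le_leftAnnihilator s ha)]
    exact zero_mem _

theorem anticomm_lieWord_of_mem (l : List X) (x z : X) :
    anticomm (lieWord K l x) (of K z) ∈ comSSpan K (x ::ₘ ↑l + {z}) := by
  induction l with
  | nil => simpa [lieWord] using foldl_anticomm_mem_comSSpan (K := K) [] x z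
  | cons y l ih =>
    rw [lieWord_cons, anticomm_lie]
    refine sub_mem ?_ ?_
    · convert of_vdash_mem_comSSpan y ih using 2
      simp only [← Multiset.cons_coe, ← Multiset.singleton_add]
      abel
    · convert lieWord_vdash_mem_comSSpan l x (foldl_anticomm_mem_comSSpan (K := K) [] y z) using 2
      rotate_left
      · rfl
      simp only [← Multiset.cons_coe, ← Multiset.singleton_add, Multiset.coe_nil, add_zero]
      abel

/-- In the recursion of `anticomm_lie`, the first term has a shorter left word and the second
contains the anticommutator of a word with a letter, which is the case settled before. -/
theorem anticomm_lieWord_mem (l l' : List X) (x y : X) :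
    anticomm (lieWord K l x) (lieWord K l' y) ∈ comSSpan K (x ::ₘ ↑l + y ::ₘ ↑l') := by
  induction l with
  | nil =>
    rw [anticomm_comm, add_comm]
    exact anticomm_lieWord_of_mem l' y x
  | cons z l ih =>
    rw [lieWord_cons, anticomm_lie]
    refine sub_mem ?_ ?_
    · convert of_vdash_mem_comSSpan z ih using 2
      simp only [← Multiset.cons_coe, ← Multiset.singleton_add]
      abel
    · rw [anticomm_comm]
      convert lieWord_vdash_mem_comSSpan l x (anticomm_lieWord_of_mem l' y z) using 2
      simp only [← Multiset.cons_coe, ← Multiset.singleton_add]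
      abel

theorem anticomm_mem_comSSpan {s t : Multiset X} {a b : A} (ha : a ∈ lieWordSpan K s)
    (hb : b ∈ lieWordSpan K t) : anticomm a b ∈ comSSpan K (s + t) := by
  induction ha using Submodule.span_induction with
  | mem a h =>
    obtain ⟨l, x, rfl, rfl⟩ := h
    induction hb using Submodule.span_induction with
    | mem b h =>
      obtain ⟨l', z, rfl, rfl⟩ := h
      exact anticomm_lieWord_mem l l' x z
    | zero => rw [anticomm, zero_vdash, vdash_zero, add_zero]; exact zero_mem _
    | add a b _ _ ha hb =>
      rw [anticomm, vdash_add, add_vdash, add_add_add_comm]; exact add_mem ha hb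
    | smul t a _ ha =>
      rw [anticomm, vdash_smul, smul_vdash, ← smul_add]; exact Submodule.smul_mem _ _ ha
  | zero => rw [anticomm, zero_vdash, vdash_zero, add_zero]; exact zero_mem _
  | add a b _ _ ha hb =>
    rw [anticomm, vdash_add, add_vdash, add_add_add_comm]; exact add_mem ha hb
  | smul t a _ ha =>
    rw [anticomm, vdash_smul, smul_vdash, ← smul_add]; exact Submodule.smul_mem _ _ ha

theorem vdash_mem_comSSpan {s t : Multiset X} {a b : A} (ha : a ∈ lieWordSpan K s)
    (hb : b ∈ comSSpan K t) : a ⊢ᵈ b ∈ comSSpan K (s + t) := by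
  induction ha using Submodule.span_induction with
  | mem a h =>
    obtain ⟨l, x, rfl, rfl⟩ := h
    exact lieWord_vdash_mem_comSSpan l x hb
  | zero => rw [zero_vdash]; exact zero_mem _
  | add a b _ _ ha hb => rw [add_vdash]; exact add_mem ha hb
  | smul t a _ ha => rw [smul_vdash]; exact Submodule.smul_mem _ _ ha

/-- The Com^S part of the left factor acts by zero. For Lie elements the product is half the
commutator plus half the anticommutator. -/
theorem vdash_mem_sup [NeZero (2 : K)] {s t : Multiset X} {a b : A}
    (h₁ : a ∈ lieWordSpan K s ⊔ comSSpan K s) (h₂ : b ∈ lieWordSpan K t ⊔ comSSpan K t) :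
    a ⊢ᵈ b ∈ lieWordSpan K (s + t) ⊔ comSSpan K (s + t) := by
  obtain ⟨a, ha, m, hm, rfl⟩ := Submodule.mem_sup.1 h₁
  obtain ⟨b, hb, n, hn, rfl⟩ := Submodule.mem_sup.1 h₂
  have two : (2 : K) ≠ 0 := NeZero.ne _
  have hab : a ⊢ᵈ b = (2 : K)⁻¹ • ⁅a, b⁆ + (2 : K)⁻¹ • anticomm a b := by
    rw [← smul_add, lie_def, anticomm, sub_add_add_cancel, ← two_smul K, smul_smul,
      inv_mul_cancel₀ two, one_smul]
  rw [add_vdash, comSSpan_le_leftAnnihilator s hm, add_zero, vdash_add, hab, add_assoc]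
  exact Submodule.add_mem_sup (Submodule.smul_mem _ _ (lie_mem_lieWordSpan ha hb))
    (add_mem (Submodule.smul_mem _ _ (anticomm_mem_comSSpan ha hb)) (vdash_mem_comSSpan ha hn))

theorem mk_monomial_mem [NeZero (2 : K)] (m : DiMonomial X) :
    mk K X (FreeDiMulAlgebra.monomial K m) ∈ lieWordSpan K m.vars ⊔ comSSpan K m.vars := by
  induction m with
  | of x => exact Submodule.mem_sup_left (Submodule.subset_span ⟨[], x, rfl, rfl⟩)
  | vdash m n hm hn =>
    rw [mk_monomial_vdash]
    exact vdash_mem_sup hm hn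
  | dashv m n hm hn =>
    rw [mk_monomial_dashv, dashv_eq, DiMonomial.vars, add_comm]
    exact neg_mem (vdash_mem_sup hn hm)

theorem range_ofLie_sup_comS [NeZero (2 : K)] :
    LinearMap.range (ofLie K X).toLinearMap ⊔ comS K X = ⊤ := by
  refine eq_top_iff.2 fun a _ => ?_
  induction a using of_induction with
  | h m =>
    refine (sup_le_sup ?_ ?_ : lieWordSpan K m.vars ⊔ comSSpan K m.vars ≤ _) (mk_monomial_mem m)
    · refine Submodule.span_le.2 ?_
      rintro _ ⟨l, x, -, rfl⟩
      exact lieWord_mem_range K l x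
    · refine Submodule.span_mono ?_
      rintro _ ⟨j, -, rfl⟩
      exact ⟨j, rfl⟩
  | h0 => exact zero_mem _
  | hadd a b ha hb => exact add_mem (ha trivial) (hb trivial)
  | hsmul t a ha => exact Submodule.smul_mem _ _ (ha trivial)

end Spanning

end FreeInitialLieDialgebra

namespace FreeInitialLieDialgebra

/-! ### Independence by models, and the basis -/

section Independence

variable (K : Type u) [Field K] (X : Type v)

local notation "A" => FreeInitialLieDialgebra K X
local notation "R" => MvPolynomial (X ⊕ X) K

/-- The product `(α, d, m) ⊢ (β, e, n) = (0, (α e - β d) / 2, α n + d e / 2)` on `R³`, where `R`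
is a polynomial ring. -/
noncomputable def polynomialModel : R × R × R →ₗ[K] R × R × R →ₗ[K] R × R × R :=
  LinearMap.mk₂ K (fun a b => (0, MvPolynomial.C 2⁻¹ * (a.1 * b.2.1 - b.1 * a.2.1),
      a.1 * b.2.2 + MvPolynomial.C 2⁻¹ * (a.2.1 * b.2.1)))
    (fun a b c => by ext1 <;> [simp; (ext1 <;> simp <;> ring)])
    (fun t a b => by
      ext1 <;> [simp; (ext1 <;> simp [MvPolynomial.smul_eq_C_mul] <;> ring)])
    (fun a b c => by ext1 <;> [simp; (ext1 <;> simp <;> ring)])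
    (fun t a b => by
      ext1 <;> [simp; (ext1 <;> simp [MvPolynomial.smul_eq_C_mul] <;> ring)])

variable {K X}

theorem polynomialModel_apply (a b : R × R × R) :
    polynomialModel K X a b = (0, MvPolynomial.C 2⁻¹ * (a.1 * b.2.1 - b.1 * a.2.1),
      a.1 * b.2.2 + MvPolynomial.C 2⁻¹ * (a.2.1 * b.2.1)) := rfl

theorem two_mul_C_inv_two [NeZero (2 : K)] : 2 * (MvPolynomial.C 2⁻¹ : R) = 1 := by
  have two : (2 : K) ≠ 0 := NeZero.ne _
  rw [show (2 : R) = MvPolynomial.C 2 from (map_ofNat _ 2).symm, ← map_mul, mul_inv_cancel₀ two,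
    map_one]

variable (K X) in
theorem exists_polynomialLift [NeZero (2 : K)] : ∃ F : A →ₗ[K] R × R × R,
    (∀ x, F (of K x) = (MvPolynomial.X (Sum.inl x), MvPolynomial.X (Sum.inr x), 0)) ∧
      ∀ a b, F (a ⊢ᵈ b) = polynomialModel K X (F a) (F b) := by
  have h := two_mul_C_inv_two (K := K) (X := X)
  refine exists_lift _ ?_ ?_ _
  · rintro ⟨α, d, m⟩ ⟨β, e, n⟩ ⟨γ, f, p⟩
    simp only [polynomialModel_apply]
    generalize (MvPolynomial.C 2⁻¹ : R) = t at *
    refine Prod.ext (by simp) (Prod.ext ?_ ?_)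
    · simp only [Prod.snd_sub, Prod.fst_sub]; ring
    -- The two sides differ by a multiple of 2t - 1, so the constant ½ of the model is essential
    -- here.
    · simp only [Prod.snd_sub]; linear_combination t * (α * e - β * d) * f * h
  · rintro ⟨α, d, m⟩ ⟨β, e, n⟩ ⟨γ, f, p⟩
    simp only [polynomialModel_apply]
    refine Prod.ext (by simp) (Prod.ext ?_ ?_)
    · simp only [Prod.snd_add, Prod.fst_add, Prod.snd_zero, Prod.fst_zero]; ring
    · simp only [Prod.snd_add, Prod.snd_zero]; ring

variable [LinearOrder X]

/-- The exponent of the image of a monomial `comSMonomial` in the polynomial model. -/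
def _root_.ComSIndex.exponent (j : ComSIndex X) : Multiset (X ⊕ X) :=
  {Sum.inr j.fst, Sum.inr j.snd} + (j.tail : Multiset X).map Sum.inl

theorem _root_.ComSIndex.ext_of_perm {i j : ComSIndex X}
    (h : ({i.fst, i.snd} : Multiset X) = {j.fst, j.snd})
    (h' : (i.tail : Multiset X) = j.tail) : i = j := by
  obtain ⟨a, b, l, hab, hl⟩ := i
  obtain ⟨c, d, l', hcd, hl'⟩ := j
  obtain rfl : l = l' := (Multiset.coe_eq_coe.1 h').eq_of_pairwise' hl hl'
  have : [a, b] = [c, d] := (Multiset.coe_eq_coe.1 h : [a, b].Perm [c, d]).eq_of_pairwise'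
    (r := (· ≤ ·)) (by simpa using hab) (by simpa using hcd)
  simp_all

/-- The two copies of `X` separate the first pair of letters from the tail, and sorting determines
each from its multiset. -/
theorem _root_.ComSIndex.exponent_injective :
    Function.Injective (ComSIndex.exponent (X := X)) := fun i j h => by
  refine ComSIndex.ext_of_perm ?_ ?_
  · have := congrArg (Multiset.filterMap Sum.getRight?) h
    refine (Multiset.coe_eq_coe.2 ?_ : (↑[i.fst, i.snd] : Multiset X) = ↑[j.fst, j.snd])
    simpa [ComSIndex.exponent, Multiset.filterMap_map, Function.comp_def] using this
  · have := congrArg (Multiset.filterMap Sum.getLeft?) h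
    simpa [ComSIndex.exponent, List.filterMap_cons, List.filterMap_map, Function.comp_def]
      using this

/-- In the anticommutator of two generators the antisymmetric middle coordinate cancels and the two
halves add up to the product of their `Sum.inr` variables. Each further letter multiplies the last
coordinate by its `Sum.inl` variable. -/
theorem exists_comSMonomial_eq_monomial [NeZero (2 : K)] : ∃ F : A →ₗ[K] R,
    ∀ j, F (comSMonomial K j) = MvPolynomial.monomial (Multiset.toFinsupp j.exponent) 1 := by
  obtain ⟨F, hof, hF⟩ := exists_polynomialLift K X
  have hfold : ∀ (l : List X) (a : A) (s : Multiset (X ⊕ X)),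
      F a = (0, 0, MvPolynomial.monomial (Multiset.toFinsupp s) 1) →
      F (l.foldl (fun a x => anticomm a (of K x)) a) =
        (0, 0, MvPolynomial.monomial (Multiset.toFinsupp (s + (l : Multiset X).map Sum.inl)) 1) := by
    intro l
    induction l with
    | nil => intro a s h; simpa using h
    | cons x l ih =>
      intro a s h
      rw [List.foldl_cons, ih _ (s + {Sum.inl x})]
      · rw [add_assoc, Multiset.singleton_add, ← Multiset.cons_coe, Multiset.map_cons]
      · rw [anticomm, map_add, hF, hF, h, hof]
        simp [polynomialModel_apply, MvPolynomial.X, MvPolynomial.monomial_mul, add_comm]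
  refine ⟨LinearMap.snd K R R ∘ₗ LinearMap.snd K R (R × R) ∘ₗ F, fun j => ?_⟩
  simp only [LinearMap.comp_apply, comSMonomial]
  rw [hfold _ _ {Sum.inr j.fst, Sum.inr j.snd}]
  · rfl
  · rw [anticomm, map_add, hF, hF, hof, hof]
    refine Prod.ext (by simp [polynomialModel_apply]) (Prod.ext ?_ ?_)
    · simp only [polynomialModel_apply, Prod.snd_add, Prod.fst_add]; ring
    · simp only [polynomialModel_apply, Prod.snd_add, mul_zero, zero_add]
      have h := two_mul_C_inv_two (K := K) (X := X)
      have h2 : MvPolynomial.monomial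
          (Multiset.toFinsupp ({Sum.inr j.fst, Sum.inr j.snd} : Multiset (X ⊕ X))) (1 : K) =
            MvPolynomial.X (Sum.inr j.fst) * MvPolynomial.X (Sum.inr j.snd) := by
        rw [MvPolynomial.X, MvPolynomial.X, MvPolynomial.monomial_mul, mul_one,
          Multiset.insert_eq_cons, ← Multiset.singleton_add, map_add, Multiset.toFinsupp_singleton,
          Multiset.toFinsupp_singleton]
      rw [h2]
      linear_combination (MvPolynomial.X (Sum.inr j.fst) * MvPolynomial.X (Sum.inr j.snd)) * h

theorem linearIndependent_comSMonomial [NeZero (2 : K)] :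
    LinearIndependent K (comSMonomial K (X := X)) := by
  obtain ⟨F, hF⟩ := exists_comSMonomial_eq_monomial (K := K) (X := X)
  refine LinearIndependent.of_comp F ?_
  have : F ∘ comSMonomial K =
      MvPolynomial.basisMonomials (X ⊕ X) K ∘ fun j => Multiset.toFinsupp j.exponent := by
    ext1 j
    simpa using hF j
  rw [this]
  exact (MvPolynomial.basisMonomials (X ⊕ X) K).linearIndependent.comp _
    (Multiset.toFinsupp.injective.comp ComSIndex.exponent_injective)

theorem exists_retraction [NeZero (2 : K)] : ∃ F : A →ₗ⁅K⁆ FreeLieAlgebra K X,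
    (∀ u, F (ofLie K X u) = u) ∧ ∀ a ∈ comS K X, F a = 0 := by
  obtain ⟨F, hof, hF⟩ := exists_lieLift (K := K) (FreeLieAlgebra.of K (X := X))
  refine ⟨F, fun u => ?_, fun a ha => ?_⟩
  · have : F.comp (ofLie K X) = LieHom.id := by
      refine FreeLieAlgebra.hom_ext fun x => ?_
      simp [ofLie, hof]
    exact LieHom.congr_fun this u
  · suffices comS K X ≤ LinearMap.ker F.toLinearMap from this ha
    refine Submodule.span_le.2 ?_
    rintro _ ⟨j, rfl⟩
    change F _ = 0
    rw [comSMonomial]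
    -- Splitting off the last letter exposes the outermost anticommutator, also for an empty tail.
    rcases List.eq_nil_or_concat j.tail with h | ⟨l, x, h⟩
    · rw [h]; exact hF _ _
    · rw [h, List.concat_eq_append, List.foldl_append]; exact hF _ _

theorem ofLie_injective [NeZero (2 : K)] : Function.Injective (ofLie K X) := by
  obtain ⟨F, hF, -⟩ := exists_retraction (K := K) (X := X)
  exact Function.LeftInverse.injective hF

theorem isCompl_range_ofLie_comS [NeZero (2 : K)] :
    IsCompl (LinearMap.range (ofLie K X).toLinearMap) (comS K X) := by
  obtain ⟨F, hF, hF'⟩ := exists_retraction (K := K) (X := X)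
  refine ⟨Submodule.disjoint_def.2 ?_, codisjoint_iff.2 range_ofLie_sup_comS⟩
  rintro _ ⟨u, rfl⟩ h
  have h0 : u = 0 := (hF u).symm.trans (hF' _ h)
  rw [h0, map_zero]

theorem exists_basis [NeZero (2 : K)] {ι : Type w} (b : Module.Basis ι K (FreeLieAlgebra K X)) :
    ∃ B : Module.Basis (ι ⊕ ComSIndex X) K A,
      (∀ i, B (Sum.inl i) = ofLie K X (b i)) ∧ ∀ j, B (Sum.inr j) = comSMonomial K j := by
  let b₁ := b.map (LinearEquiv.ofInjective (ofLie K X).toLinearMap ofLie_injective)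
  let b₂ : Module.Basis (ComSIndex X) K (comS K X) :=
    Module.Basis.span linearIndependent_comSMonomial
  refine ⟨(b₁.prod b₂).map (Submodule.prodEquivOfIsCompl _ _ isCompl_range_ofLie_comS),
    fun i => ?_, fun j => ?_⟩
  · have h : (b₁.prod b₂) (Sum.inl i) = (b₁ i, 0) := by simp
    rw [Module.Basis.map_apply, h, Submodule.coe_prodEquivOfIsCompl', ZeroMemClass.coe_zero,
      add_zero]
    rfl
  · have h : (b₁.prod b₂) (Sum.inr j) = (0, b₂ j) := by simp
    rw [Module.Basis.map_apply, h, Submodule.coe_prodEquivOfIsCompl', ZeroMemClass.coe_zero,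
      zero_add]
    exact congrArg Subtype.val (Module.Basis.span_apply linearIndependent_comSMonomial j)

end Independence

/-! ### Dimension of the multilinear component -/

section Multilinear

variable {K : Type u} [Field K] {X : Type v}

local notation "A" => FreeInitialLieDialgebra K X

open Classical in
-- Send `z` to E₀₁ and every other letter y to y E₀₀, over the free associative algebra. As E₀₁E₀₀ =
-- 0, the bracket of y E₀₀ with w E₀₁ is yw E₀₁, so the entry (0,1) of the image of `lieWord K l z`
-- is the word `l` itself.
theorem linearIndependent_lieWord [NeZero (2 : K)] (z : X) :
    LinearIndependent K (fun l : {l : List X // z ∉ l} => lieWord K l.1 z) := by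
  let _ : LieRing (Matrix (Fin 2) (Fin 2) (MonoidAlgebra K (FreeMonoid X))) :=
    LieRing.ofAssociativeRing
  obtain ⟨F, hof, -⟩ := exists_lieLift (K := K) (X := X)
    (L := Matrix (Fin 2) (Fin 2) (MonoidAlgebra K (FreeMonoid X)))
    (fun y => if y = z then Matrix.single 0 1 1 else
      Matrix.single 0 0 (MonoidAlgebra.single (FreeMonoid.of y) 1))
  have hF : ∀ l : List X, z ∉ l → F (lieWord K l z) =
      Matrix.single 0 1 (MonoidAlgebra.single (FreeMonoid.ofList l) 1) := by
    intro l
    induction l with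
    | nil => intro _; rw [lieWord, List.foldr_nil, hof, if_pos rfl]; rfl
    | cons y l ih =>
      intro h
      simp only [List.mem_cons, not_or] at h
      rw [lieWord_cons, LieHom.map_lie, ih h.2, hof, if_neg (Ne.symm h.1), Ring.lie_def,
        Matrix.single_mul_single_same, Matrix.single_mul_single_of_ne (h := by decide), sub_zero,
        MonoidAlgebra.single_mul_single, one_mul]
      rfl
  let G : A →ₗ[K] MonoidAlgebra K (FreeMonoid X) :=
    Matrix.entryLinearMap K (MonoidAlgebra K (FreeMonoid X)) (0 : Fin 2) (1 : Fin 2) ∘ₗ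
      F.toLinearMap
  refine LinearIndependent.of_comp G ?_
  have : G ∘ (fun l : {l : List X // z ∉ l} => lieWord K l.1 z) =
      (fun w : FreeMonoid X => MonoidAlgebra.single w (1 : K)) ∘
        fun l : {l : List X // z ∉ l} => FreeMonoid.ofList l.1 := by
    ext1 l
    change F (lieWord K l.1 z) 0 1 = _
    rw [hF l.1 l.2, Matrix.single_apply_same]
    rfl
  rw [this]
  refine LinearIndependent.comp ?_ _ (FreeMonoid.ofList.injective.comp Subtype.val_injective)
  exact (MonoidAlgebra.basis (FreeMonoid X) K).linearIndependent

variable (K) in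
/-- The span of the nonassociative monomials of content `s`. -/
noncomputable def monomialSpan (s : Multiset X) : Submodule K A :=
  Submodule.span K ((fun m => mk K X (FreeDiMulAlgebra.monomial K m)) '' {m | m.vars = s})

theorem vdash_mem_monomialSpan {s t : Multiset X} {a b : A} (ha : a ∈ monomialSpan K s)
    (hb : b ∈ monomialSpan K t) : a ⊢ᵈ b ∈ monomialSpan K (s + t) := by
  unfold monomialSpan at ha hb
  induction ha using Submodule.span_induction with
  | mem a h =>
    obtain ⟨m, rfl, rfl⟩ := h
    induction hb using Submodule.span_induction with
    | mem b h =>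
      obtain ⟨n, rfl, rfl⟩ := h
      exact Submodule.subset_span ⟨.vdash m n, rfl, mk_monomial_vdash m n⟩
    | zero => rw [vdash_zero]; exact zero_mem _
    | add a b _ _ ha hb => rw [vdash_add]; exact add_mem ha hb
    | smul t a _ ha => rw [vdash_smul]; exact Submodule.smul_mem _ _ ha
  | zero => rw [zero_vdash]; exact zero_mem _
  | add a b _ _ ha hb => rw [add_vdash]; exact add_mem ha hb
  | smul t a _ ha => rw [smul_vdash]; exact Submodule.smul_mem _ _ ha

theorem of_mem_monomialSpan (x : X) : of K x ∈ monomialSpan K {x} :=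
  Submodule.subset_span ⟨.of x, rfl, rfl⟩

theorem anticomm_mem_monomialSpan {s t : Multiset X} {a b : A} (ha : a ∈ monomialSpan K s)
    (hb : b ∈ monomialSpan K t) : anticomm a b ∈ monomialSpan K (s + t) :=
  add_mem (vdash_mem_monomialSpan ha hb) (add_comm s t ▸ vdash_mem_monomialSpan hb ha)

theorem lie_mem_monomialSpan {s t : Multiset X} {a b : A} (ha : a ∈ monomialSpan K s)
    (hb : b ∈ monomialSpan K t) : ⁅a, b⁆ ∈ monomialSpan K (s + t) :=
  sub_mem (vdash_mem_monomialSpan ha hb) (add_comm s t ▸ vdash_mem_monomialSpan hb ha)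

theorem lieWord_mem_monomialSpan (l : List X) (z : X) :
    lieWord K l z ∈ monomialSpan K (z ::ₘ ↑l) := by
  induction l with
  | nil => exact of_mem_monomialSpan z
  | cons y l ih =>
    rw [← Multiset.cons_coe, Multiset.cons_swap, ← Multiset.singleton_add y]
    exact lie_mem_monomialSpan (of_mem_monomialSpan y) ih

theorem comSMonomial_mem_monomialSpan [LinearOrder X] (j : ComSIndex X) :
    comSMonomial K j ∈ monomialSpan K j.vars := by
  have hfold : ∀ (l : List X) (s : Multiset X) (a : A), a ∈ monomialSpan K s →
      l.foldl (fun a x => anticomm a (of K x)) a ∈ monomialSpan K (s + (l : Multiset X)) := by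
    intro l
    induction l with
    | nil => intro s a h; simpa using h
    | cons x l ih =>
      intro s a h
      rw [← Multiset.cons_coe, ← Multiset.singleton_add, ← add_assoc]
      exact ih _ _ (anticomm_mem_monomialSpan h (of_mem_monomialSpan x))
  have hvars : j.vars = {j.fst} + {j.snd} + (j.tail : Multiset X) := by
    rw [add_assoc, Multiset.singleton_add, Multiset.singleton_add, ComSIndex.vars]
  rw [hvars]
  exact hfold j.tail _ _ (anticomm_mem_monomialSpan (of_mem_monomialSpan (K := K) j.fst)
    (of_mem_monomialSpan j.snd))

theorem monomialSpan_eq [NeZero (2 : K)] [LinearOrder X] {z : X} {s : Multiset X} (hz : z ∈ s) :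
    monomialSpan K s = lieWordSpanOf K z s ⊔ comSSpan K s := by
  refine le_antisymm (Submodule.span_le.2 ?_) (sup_le (Submodule.span_le.2 ?_)
    (Submodule.span_le.2 ?_))
  · rintro _ ⟨m, rfl, rfl⟩
    have hle : lieWordSpan K m.vars ⊔ comSSpan K m.vars ≤
        lieWordSpanOf K z m.vars ⊔ comSSpan K m.vars := sup_le_sup_right (lieWordSpan_le hz) _
    exact hle (mk_monomial_mem m)
  · rintro _ ⟨l, rfl, rfl⟩
    exact lieWord_mem_monomialSpan l z
  · rintro _ ⟨j, rfl, rfl⟩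
    exact comSMonomial_mem_monomialSpan j

/-- The monomials `comSMonomial` in which each of the `n` variables occurs exactly once correspond
to the pairs `i₁ < i₂`. -/
noncomputable def multilinearComSIndexEquiv (n : ℕ) :
    {j : ComSIndex (Fin n) // j.vars = Finset.univ.val} ≃ {p : Fin n × Fin n // p.1 < p.2} :=
  Equiv.ofBijective (fun j => ⟨(j.1.fst, j.1.snd), by
    refine lt_of_le_of_ne j.1.fst_le_snd fun h => ?_
    have := j.2 ▸ (Finset.univ : Finset (Fin n)).nodup
    rw [ComSIndex.vars, Multiset.nodup_cons] at this
    exact this.1 (Multiset.mem_cons.2 (Or.inl h))⟩) (by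
    constructor
    · rintro ⟨i, hi⟩ ⟨j, hj⟩ h
      simp only [Subtype.mk.injEq, Prod.mk.injEq] at h
      have hij := hi.trans hj.symm
      rw [ComSIndex.vars, ComSIndex.vars, h.1, h.2, Multiset.cons_inj_right,
        Multiset.cons_inj_right] at hij
      exact Subtype.ext (ComSIndex.ext_of_perm (by rw [h.1, h.2]) hij)
    · rintro ⟨⟨i, j⟩, h⟩
      -- The tail is forced: it lists the remaining variables in increasing order.
      refine ⟨⟨⟨i, j, ((Finset.univ.erase i).erase j).sort (· ≤ ·), le_of_lt h,
        Finset.pairwise_sort _ _⟩, ?_⟩, rfl⟩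
      simp only [ComSIndex.vars, Finset.sort_eq, Finset.erase_val]
      rw [Multiset.cons_erase, Multiset.cons_erase (Finset.mem_univ i)]
      exact Finset.mem_erase.2 ⟨h.ne', Finset.mem_univ j⟩)

theorem card_fin_lt (n : ℕ) :
    Fintype.card {p : Fin n × Fin n // p.1 < p.2} = n * (n - 1) / 2 := by
  rw [Fintype.card_subtype, Finset.card_filter, ← Finset.univ_product_univ,
    Finset.sum_product_right]
  simp only [← Finset.card_filter]
  rw [← Finset.sum_range_id, ← Fin.sum_univ_eq_sum_range (fun i => i)]
  refine Finset.sum_congr rfl fun j _ => ?_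
  rw [← Fin.card_Iio j]
  congr 1
  ext i
  simp

/-- The letter 0 is fixed as the last letter of the Lie words, so these are indexed by the
permutations of the other `k` letters. -/
theorem finrank_multilinear [NeZero (2 : K)] (k : ℕ) :
    Module.finrank K (multilinear K (k + 1)) = k.factorial + (k + 1) * k / 2 := by
  let s : Multiset (Fin (k + 1)) := Finset.univ.val
  let L := (Finset.univ.erase (0 : Fin (k + 1))).toList
  have hL : ∀ l : List (Fin (k + 1)), l ∈ L.permutations ↔ (0 : Fin (k + 1)) ::ₘ ↑l = s := by
    intro l
    rw [List.mem_permutations, ← Multiset.coe_eq_coe, Finset.coe_toList, Finset.erase_val,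
      ← Multiset.cons_inj_right 0, Multiset.cons_erase (Finset.mem_univ _)]
  let I := {l // l ∈ L.permutations.toFinset}
  let J := {j : ComSIndex (Fin (k + 1)) // j.vars = s}
  have hI0 : ∀ l : I, (0 : Fin (k + 1)) ∉ l.1 := fun l h => by
    have h1 := (hL l.1).1 (List.mem_toFinset.1 l.2)
    have h2 : s.Nodup := Finset.univ.nodup
    rw [← h1, Multiset.nodup_cons] at h2
    exact h2.1 h
  have hIcard : Fintype.card I = k.factorial := by
    rw [Fintype.card_coe, List.toFinset_card_of_nodup (List.nodup_permutations _
      (Finset.nodup_toList _)), List.length_permutations, Finset.length_toList,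
      Finset.card_erase_of_mem (Finset.mem_univ _), Finset.card_univ, Fintype.card_fin,
      Nat.add_sub_cancel]
  let _ : Fintype J := Fintype.ofEquiv _ (multilinearComSIndexEquiv (k + 1)).symm
  have hJcard : Fintype.card J = (k + 1) * k / 2 :=
    (Fintype.card_congr (multilinearComSIndexEquiv (k + 1))).trans (card_fin_lt (k + 1))
  let v : I → FreeInitialLieDialgebra K (Fin (k + 1)) := fun l => lieWord K l.1 0
  let w : J → FreeInitialLieDialgebra K (Fin (k + 1)) := fun j => comSMonomial K j.1
  have hv : LinearIndependent K v :=
    (linearIndependent_lieWord (K := K) (0 : Fin (k + 1))).comp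
      (fun l : I => ⟨l.1, hI0 l⟩) fun a b h => Subtype.ext (by simpa using h)
  have hw : LinearIndependent K w :=
    linearIndependent_comSMonomial.comp _ Subtype.val_injective
  have hvw : LinearIndependent K (Sum.elim v w) := by
    -- The two families lie in the complementary subspaces φ(Lie⟨X⟩) and Com^S⟨X⟩.
    refine hv.sum_type hw (isCompl_range_ofLie_comS.disjoint.mono (Submodule.span_le.2 ?_)
      (Submodule.span_mono ?_))
    · rintro _ ⟨l, rfl⟩
      exact lieWord_mem_range K l.1 0
    · rintro _ ⟨j, rfl⟩
      exact ⟨j.1, rfl⟩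
  have hspan : multilinear K (k + 1) = Submodule.span K (Set.range (Sum.elim v w)) := by
    refine (monomialSpan_eq (z := 0) (Finset.mem_univ (0 : Fin (k + 1)))).trans ?_
    rw [Set.Sum.elim_range, Submodule.span_union, lieWordSpanOf, comSSpan]
    congr 2
    · ext a
      constructor
      · rintro ⟨l, hl, rfl⟩
        exact ⟨⟨l, List.mem_toFinset.2 ((hL l).2 hl)⟩, rfl⟩
      · rintro ⟨l, rfl⟩
        exact ⟨l.1, (hL l.1).1 (List.mem_toFinset.1 l.2), rfl⟩
    · ext a
      constructor
      · rintro ⟨j, hj, rfl⟩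
        exact ⟨⟨j, hj⟩, rfl⟩
      · rintro ⟨j, rfl⟩
        exact ⟨j.1, j.2, rfl⟩
  rw [hspan, finrank_span_eq_card hvw, Fintype.card_sum, hIcard, hJcard]

end Multilinear

end FreeInitialLieDialgebra

theorem theorem4p1 {K : Type u} [Field K] [CharZero K] :
    (∀ (X : Type v) [LinearOrder X],
      (∀ (ι : Type w) (b : Module.Basis ι K (FreeLieAlgebra K X)),
        ∃ B : Module.Basis (ι ⊕ ComSIndex X) K (FreeInitialLieDialgebra K X),
          (∀ i, B (Sum.inl i) = FreeInitialLieDialgebra.ofLie K X (b i)) ∧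
          (∀ j, B (Sum.inr j) = FreeInitialLieDialgebra.comSMonomial K j)) ∧
      Function.Injective (FreeInitialLieDialgebra.ofLie K X) ∧
      IsCompl (LinearMap.range (FreeInitialLieDialgebra.ofLie K X).toLinearMap)
        (FreeInitialLieDialgebra.comS K X)) ∧
    (∀ n : ℕ, 1 ≤ n →
      Module.finrank K (FreeInitialLieDialgebra.multilinear K n) =
        (n - 1).factorial + n * (n - 1) / 2) := by
  refine ⟨fun X _ => ⟨fun ι b => FreeInitialLieDialgebra.exists_basis b,
    FreeInitialLieDialgebra.ofLie_injective,
    FreeInitialLieDialgebra.isCompl_range_ofLie_comS⟩, fun n hn => ?_⟩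
  -- Writing n = k + 1 provides the variable 0 used as the last letter.
  obtain ⟨k, rfl⟩ := Nat.exists_eq_add_of_le' hn
  exact FreeInitialLieDialgebra.finrank_multilinear k
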